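/- Let $G$ be a compact topological group. A $G$-space is a topological space with a continuous action $G\times X\to X$; a $G$-map is a continuous equivariant map; $\simeq_G$ denotes equivariant homotopy. A $G$-ANR is a metrizable $G$-space $Y$ such that, whenever $Y$ is a closed invariant subset of a metrizable $G$-space $Z$, there are an invariant neighbourhood $U$ of $Y$ in $Z$ and a $G$-retraction $U\to Y$. An inverse $G$-ANR system $\{X_\alpha,p_{\alpha\alpha'},A\}$ (an inverse system of $G$-ANRs and $G$-maps over a non-empty directed set $A$) is associated with a $G$-space $X$ if there are $G$-maps $p_\alpha:X\to X_\alpha$ with $p_\alpha\simeq_G p_{\alpha\alpha'}p_{\alpha'}$ for $\alpha\le\alpha'$ such that, for every $G$-ANR $P$, (1) every $G$-map $f:X\to P$ satisfies $f\simeq_G h\,p_\alpha$ for some $\alpha$ and some $G$-map $h:X_\alpha\to P$, and (2) if $\varphi p_\alpha\simeq_G\psi p_\alpha$ for $G$-maps $\varphi,\psi:X_\alpha\to P$, then $\varphi p_{\alpha\alpha'}\simeq_G\psi p_{\alpha\alpha'}$ for some $\alpha'\ge\alpha$. A $G$-space $X$ is $G$-movable if some inverse $G$-ANR system associated with it is $G$-movable,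 that is, for every $\alpha$ there is $\alpha'\ge\alpha$ such that for every $\alpha''\ge\alpha$ there is a $G$-map $r:X_{\alpha'}\to X_{\alpha''}$ with $p_{\alpha\alpha''}r\simeq_G p_{\alpha\alpha'}$. A $G$-shape morphism $X\to Y$ is the class of a map $\{f_\beta,\varphi\}$ from an inverse $G$-ANR system $\{X_\alpha,p_{\alpha\alpha'},A\}$ associated with $X$ to an inverse $G$-ANR system $\{Y_\beta,q_{\beta\beta'},B\}$ associated with $Y$: here $\varphi:B\to A$ is a function and $f_\beta:X_{\varphi(\beta)}\to Y_\beta$ are $G$-maps such that for $\beta\le\beta'$ there is $\alpha\ge\varphi(\beta),\varphi(\beta')$ with $f_\beta p_{\varphi(\beta)\alpha}\simeq_G q_{\beta\beta'}f_{\beta'}p_{\varphi(\beta')\alpha}$ (two such maps $F:\underline X\to\underline Y$ and $F':\underline X'\to\underline Y'$ are identified if $F'\circ i$ and $j\circ F$ are equivalent maps of systems, where $i:\underline X\to\underline X'$ and $j:\underline Y\to\underline Y'$ are the comparison maps compatible up to $\simeq_G$ with the projections from $X$ and from $Y$; maps $\{f_\beta,\varphi\}$ and $\{g_\beta,\psi\}$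 between the same systems are equivalent if for every $\beta$ there is $\alpha\ge\varphi(\beta),\psi(\beta)$ with $f_\beta p_{\varphi(\beta)\alpha}\simeq_G g_\beta p_{\psi(\beta)\alpha}$). Two $G$-spaces $X,Y$ are weakly equivariantly shape comparable if there exist $G$-shape morphisms both $X\to Y$ and $Y\to X$. An inverse $G$-ANR sequence $\{X_k,p_{k,l}\}_{k\in\mathbb N}$ is canonical if for every $k$ there is a $G$-map $r^{k,k+1}:X_k\to X_{k+1}$ with $p_{j,k+1}r^{k,k+1}\simeq_G p_{j,k}$ for all $j<k$. Theorem. Every compact metrizable $G$-movable $G$-space $X$ is weakly equivariantly shape comparable with some $G$-ANR. More precisely, there is a canonical inverse $G$-ANR sequence $\{X_k,p_{k,l}\}$ associated with $X$ such that every $X_k$ is weakly equivariantly shape comparable with $X$. -/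

import Mathlib

open Topology

universe u w

/-- A `G`-space: a topological space with a (jointly) continuous action of `G`. -/
structure GSpace (G : Type u) [Group G] [TopologicalSpace G] : Type (u + 1) where
  carrier : Type u
  [top : TopologicalSpace carrier]
  [act : MulAction G carrier]
  [cont : ContinuousSMul G carrier]

namespace GSpace

instance (G : Type u) [Group G] [TopologicalSpace G] : CoeSort (GSpace G) (Type u) :=
  ⟨GSpace.carrier⟩

attribute [instance] GSpace.top GSpace.act GSpace.cont

/-- An invariant subset of a `G`-space is itself a `G`-space. -/
def ofInvariant {G : Type u} [Group G] [TopologicalSpace G] (Z : GSpace G)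
    (U : SubMulAction G Z) : GSpace G where
  carrier := U

end GSpace

/-- A `G`-map: a continuous equivariant map. -/
structure GMap {G : Type u} [Group G] [TopologicalSpace G] (X Y : GSpace G) extends C(X, Y) where
  map_smul' : ∀ (g : G) (x : X), toFun (g • x) = g • toFun x

namespace GMap

variable {G : Type u} [Group G] [TopologicalSpace G] {X Y Z : GSpace G}

instance : FunLike (GMap X Y) X Y where
  coe f := f.toFun
  coe_injective f h e := by
    cases f
    cases h
    congr
    exact DFunLike.coe_injective e

/-- The identity `G`-map. -/
def id (X : GSpace G) : GMap X X where
  toContinuousMap := ContinuousMap.id X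
  map_smul' _ _ := rfl

/-- Composition of `G`-maps, `h.comp f = h ∘ f`. -/
def comp (h : GMap Y Z) (f : GMap X Y) : GMap X Z where
  toContinuousMap := h.toContinuousMap.comp f.toContinuousMap
  map_smul' g x := (congrArg h.toFun (f.map_smul' g x)).trans (h.map_smul' g (f.toFun x))

/-- `G`-homotopy of `G`-maps: a homotopy which is equivariant, `G` acting trivially on `[0,1]`. -/
def Homotopic (f₀ f₁ : GMap X Y) : Prop :=
  ∃ F : ContinuousMap.Homotopy f₀.toContinuousMap f₁.toContinuousMap,
    ∀ (g : G) (t : unitInterval) (x : X), F (t, g • x) = g • F (t, x)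

end GMap

/-- `Y` is a `G`-ANR (for the class of metrizable `G`-spaces): it is metrizable and, whenever it is
embedded as a closed invariant subset in a metrizable `G`-space `Z`, some invariant neighbourhood
of it admits a `G`-retraction onto it. -/
def IsGANR {G : Type u} [Group G] [TopologicalSpace G] (Y : GSpace G) : Prop :=
  TopologicalSpace.MetrizableSpace Y ∧
    ∀ Z : GSpace G, TopologicalSpace.MetrizableSpace Z →
      ∀ i : GMap Y Z, IsClosedEmbedding i →
        ∃ U : SubMulAction G Z, (U : Set Z) ∈ 𝓝ˢ (Set.range i) ∧
          ∃ r : GMap (Z.ofInvariant U) Y, ∀ (y : Y) (h : i y ∈ U), r ⟨i y, h⟩ = y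

/-- An inverse `G`-ANR system over a directed set `A`: an inverse system of `G`-spaces and
`G`-maps all of whose terms are `G`-ANRs. -/
structure GANRSystem (G : Type u) [Group G] [TopologicalSpace G] (A : Type w) [Preorder A]
    [IsDirectedOrder A] [Nonempty A] where
  obj : A → GSpace G
  isGANR : ∀ a, IsGANR (obj a)
  /-- the bonding `G`-map `X_{a'} → X_a` for `a ≤ a'` -/
  p : ∀ {a a' : A}, a ≤ a' → GMap (obj a') (obj a)
  p_refl : ∀ a : A, p (le_refl a) = GMap.id (obj a)
  p_trans : ∀ {a b c : A} (hab : a ≤ b) (hbc : b ≤ c),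
    (p hab).comp (p hbc) = p (hab.trans hbc)

namespace GANRSystem

variable {G : Type u} [Group G] [TopologicalSpace G]
variable {A : Type w} [Preorder A] [IsDirectedOrder A] [Nonempty A]
variable {B : Type w} [Preorder B] [IsDirectedOrder B] [Nonempty B]

/-- The data `p_a : X → X_a` exhibiting the system `S` as associated with the `G`-space `X`. -/
structure Association (S : GANRSystem G A) (X : GSpace G) where
  proj : ∀ a, GMap X (S.obj a)
  compat : ∀ {a a' : A} (h : a ≤ a'), (proj a).Homotopic ((S.p h).comp (proj a'))
  factor : ∀ P : GSpace G, IsGANR P → ∀ f : GMap X P,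
    ∃ (a : A) (h : GMap (S.obj a) P), (h.comp (proj a)).Homotopic f
  unique : ∀ P : GSpace G, IsGANR P → ∀ (a : A) (φ ψ : GMap (S.obj a) P),
    (φ.comp (proj a)).Homotopic (ψ.comp (proj a)) →
      ∃ (a' : A) (h : a ≤ a'), (φ.comp (S.p h)).Homotopic (ψ.comp (S.p h))

/-- The system `S` is associated with the `G`-space `X`. -/
def IsAssociated (S : GANRSystem G A) (X : GSpace G) : Prop :=
  Nonempty (S.Association X)

/-- Equivariant movability of an inverse `G`-ANR system. -/
def IsMovable (S : GANRSystem G A) : Prop :=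
  ∀ a : A, ∃ (a' : A) (h' : a ≤ a'), ∀ (a'' : A) (h'' : a ≤ a''),
    ∃ r : GMap (S.obj a') (S.obj a''), ((S.p h'').comp r).Homotopic (S.p h')

/-- A map of inverse `G`-ANR systems `S → T`, that is, a pair `{f_b, φ}`. -/
structure Hom (S : GANRSystem G A) (T : GANRSystem G B) where
  φ : B → A
  f : ∀ b, GMap (S.obj (φ b)) (T.obj b)
  coherent : ∀ {b b' : B} (h : b ≤ b'), ∃ (a : A) (ha : φ b ≤ a) (ha' : φ b' ≤ a),
    ((f b).comp (S.p ha)).Homotopic (((T.p h).comp (f b')).comp (S.p ha'))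

/-- A map of systems `F : S → S'` between two systems associated with the same space is compatible
with the projections `X → S` and `X → S'`. -/
def Hom.Over {X : GSpace G} {S : GANRSystem G A} {T : GANRSystem G B} (F : S.Hom T)
    (α : S.Association X) (β : T.Association X) : Prop :=
  ∀ b, ((F.f b).comp (α.proj (F.φ b))).Homotopic (β.proj b)

/-- A canonical inverse `G`-ANR sequence. -/
def IsCanonical (S : GANRSystem G ℕ) : Prop :=
  ∀ k : ℕ, ∃ r : GMap (S.obj k) (S.obj (k + 1)), ∀ (j : ℕ) (h : j < k),
    ((S.p (h.le.trans k.le_succ)).comp r).Homotopic (S.p h.le)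

end GANRSystem

/-- A `G`-space is equivariantly movable if some inverse `G`-ANR system associated with it is. -/
def IsGMovable {G : Type u} [Group G] [TopologicalSpace G] (X : GSpace G) : Prop :=
  ∃ (A : Type u) (_ : Preorder A) (_ : IsDirectedOrder A) (_ : Nonempty A) (S : GANRSystem G A),
    S.IsAssociated X ∧ S.IsMovable

/-- A representative of a `G`-shape morphism `X → Y`: a map between inverse `G`-ANR systems
associated with `X` and with `Y`. -/
structure GShapeRep {G : Type u} [Group G] [TopologicalSpace G] (X Y : GSpace G) where
  A : Type u
  [preA : Preorder A]
  [dirA : IsDirectedOrder A]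
  [neA : Nonempty A]
  B : Type u
  [preB : Preorder B]
  [dirB : IsDirectedOrder B]
  [neB : Nonempty B]
  S : GANRSystem G A
  T : GANRSystem G B
  assocS : S.Association X
  assocT : T.Association Y
  F : S.Hom T

attribute [instance] GShapeRep.preA GShapeRep.dirA GShapeRep.neA
  GShapeRep.preB GShapeRep.dirB GShapeRep.neB

/-- Two representatives `F : S → T` and `F' : S' → T'` give the same `G`-shape morphism if, with
the comparison maps `i : S → S'` and `j : T → T'` of associated systems, `F' ∘ i` and `j ∘ F` are
equivalent maps of systems `S → T'`. -/
def GShapeRep.Rel {G : Type u} [Group G] [TopologicalSpace G] {X Y : GSpace G}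
    (M M' : GShapeRep X Y) : Prop :=
  ∃ i : M.S.Hom M'.S, i.Over M.assocS M'.assocS ∧
  ∃ j : M.T.Hom M'.T, j.Over M.assocT M'.assocT ∧
    ∀ b : M'.B, ∃ (a : M.A) (h₁ : i.φ (M'.F.φ b) ≤ a) (h₂ : M.F.φ (j.φ b) ≤ a),
      (((M'.F.f b).comp (i.f (M'.F.φ b))).comp (M.S.p h₁)).Homotopic
        (((j.f b).comp (M.F.f (j.φ b))).comp (M.S.p h₂))

/-- `G`-shape morphisms `X → Y`. -/
def GShapeMorphism {G : Type u} [Group G] [TopologicalSpace G] (X Y : GSpace G) : Type (u + 1) :=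
  Quot (GShapeRep.Rel (X := X) (Y := Y))

/-- `X` and `Y` are weakly equivariantly shape comparable: there are `G`-shape morphisms both from
`X` to `Y` and from `Y` to `X`. -/
def WeaklyGShapeComparable {G : Type u} [Group G] [TopologicalSpace G] (X Y : GSpace G) : Prop :=
  Nonempty (GShapeMorphism X Y) ∧ Nonempty (GShapeMorphism Y X)

/-! For a normed space E, left translation makes C(G, E) a G-space, and evaluation at 1 turns G-maps
into C(G, E) into arbitrary continuous maps into E, bijectively. So Dugundji's theorem makes C(G, E)
an equivariant absolute extensor for metrizable G-spaces, with no averaging over G. Open invariant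
subsets of C(G, E) are therefore G-ANRs (`isGANR_of_isOpen`), and every G-ANR is an equivariant
neighbourhood extensor (`IsGANR.exists_extension`). Embed X in such a space. Translations are
isometries, so the neighbourhoods of X of radius 1/(n+1) are invariant; they form a sequence
associated with X (`GSpace.exists_isAssociated_sequence`).

Movability passes between systems associated with the same space (`Association.isMovable`), so this
sequence is movable, and a subsequence that grows past the movability indices is canonical. In a
canonical sequence, the iterates of the maps r from X_k, projected back to a fixed X_j, are
eventually constant up to G-homotopy. Hence X_k maps coherently to the whole sequence
(`IsCanonical.exists_coherent`), which is a shape morphism from X_k to X; the projection of X to X_k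
gives the opposite one. -/

namespace GMap

variable {G : Type u} [Group G] [TopologicalSpace G] {X Y Z : GSpace G}

/-! ### Equivariant homotopy is a congruence -/

theorem continuous (f : GMap X Y) : Continuous f := f.toContinuousMap.continuous

theorem map_smul (f : GMap X Y) (g : G) (x : X) : f (g • x) = g • f x := f.map_smul' g x

theorem Homotopic.refl (f : GMap X Y) : f.Homotopic f :=
  ⟨ContinuousMap.Homotopy.refl _, fun g _ x => f.map_smul g x⟩

theorem Homotopic.of_eq {f k : GMap X Y} (h : f = k) : f.Homotopic k := h ▸ .refl f

theorem Homotopic.symm {f k : GMap X Y} : f.Homotopic k → k.Homotopic f := by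
  rintro ⟨F, hF⟩
  exact ⟨F.symm, fun g t x => hF g _ x⟩

theorem Homotopic.trans {f k l : GMap X Y} : f.Homotopic k → k.Homotopic l → f.Homotopic l := by
  rintro ⟨F, hF⟩ ⟨F', hF'⟩
  refine ⟨F.trans F', fun g t x => ?_⟩
  rw [ContinuousMap.Homotopy.trans_apply, ContinuousMap.Homotopy.trans_apply]
  split_ifs
  · exact hF _ _ _
  · exact hF' _ _ _

/-- Post-composition preserves `G`-homotopy. -/
theorem Homotopic.postcomp {f k : GMap X Y} (h : f.Homotopic k) (l : GMap Y Z) :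
    (l.comp f).Homotopic (l.comp k) := by
  obtain ⟨F, hF⟩ := h
  refine ⟨⟨⟨fun p => l (F p), l.continuous.comp F.continuous⟩, fun x => ?_, fun x => ?_⟩,
    fun g t x => ?_⟩
  · exact congrArg l (F.apply_zero x)
  · exact congrArg l (F.apply_one x)
  · exact (congrArg l (hF g t x)).trans (l.map_smul _ _)

/-- Pre-composition preserves `G`-homotopy. -/
theorem Homotopic.precomp {f k : GMap Y Z} (h : f.Homotopic k) (l : GMap X Y) :
    (f.comp l).Homotopic (k.comp l) := by
  obtain ⟨F, hF⟩ := h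
  refine ⟨⟨⟨fun p => F (p.1, l p.2), by
    have := l.continuous
    fun_prop⟩, fun x => ?_, fun x => ?_⟩, fun g t x => ?_⟩
  · exact F.apply_zero (l x)
  · exact F.apply_one (l x)
  · exact (congrArg (fun y => F (t, y)) (l.map_smul g x)).trans (hF _ _ _)

end GMap

/-! ### Associated systems, movability and canonical sequences -/

namespace GANRSystem

variable {G : Type u} [Group G] [TopologicalSpace G]
variable {A : Type*} [Preorder A] [IsDirectedOrder A] [Nonempty A]
variable {B : Type*} [Preorder B] [IsDirectedOrder B] [Nonempty B]
variable {X : GSpace G} {S : GANRSystem G A} {T : GANRSystem G B}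

theorem p_comp_comp (S : GANRSystem G A) {a b c : A} (hab : a ≤ b) (hbc : b ≤ c) {W : GSpace G}
    (f : GMap W (S.obj c)) :
    (S.p hab).comp ((S.p hbc).comp f) = (S.p (hab.trans hbc)).comp f := by
  rw [← S.p_trans hab hbc]; rfl

namespace Association

/-- `G`-maps from two terms of an associated system which agree on `X` agree on a late term. -/
theorem unique_ge (α : S.Association X) {P : GSpace G} (hP : IsGANR P) {a b : A}
    (φ : GMap (S.obj a) P) (ψ : GMap (S.obj b) P)
    (h : (φ.comp (α.proj a)).Homotopic (ψ.comp (α.proj b))) :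
    ∃ (c : A) (ha : a ≤ c) (hb : b ≤ c), (φ.comp (S.p ha)).Homotopic (ψ.comp (S.p hb)) := by
  obtain ⟨c, ha, hb⟩ := exists_ge_ge a b
  obtain ⟨d, hd, H⟩ := α.unique P hP c (φ.comp (S.p ha)) (ψ.comp (S.p hb))
    (((α.compat ha).symm.postcomp φ).trans (h.trans ((α.compat hb).postcomp ψ)))
  refine ⟨d, ha.trans hd, hb.trans hd, ?_⟩
  rw [← S.p_trans ha hd, ← S.p_trans hb hd]
  exact H

/-- Movability depends only on the space with which a system is associated. -/
theorem isMovable (α : S.Association X) (β : T.Association X) (hS : S.IsMovable) :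
    T.IsMovable := by
  intro n
  -- The index `n` is carried to `S` by `h`, moved there from `a` to `a'`, and carried back by `k`;
  -- `n'` is a stage where this round trip agrees with the bonding map. It is fixed before `n''` is
  -- given.
  obtain ⟨a, h, hh⟩ := α.factor _ (T.isGANR n) (β.proj n)
  obtain ⟨a', haa', hmov⟩ := hS a
  obtain ⟨m, k, hk⟩ := β.factor _ (S.isGANR a') (α.proj a')
  obtain ⟨n', hnn', hmn', H⟩ := β.unique_ge (T.isGANR n) (GMap.id _)
    ((h.comp (S.p haa')).comp k)
    (hh.symm.trans (((α.compat haa').postcomp h).trans (hk.symm.postcomp (h.comp (S.p haa')))))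
  refine ⟨n', hnn', fun n'' hnn'' => ?_⟩
  obtain ⟨b, l, hl⟩ := α.factor _ (T.isGANR n'') (β.proj n'')
  obtain ⟨a'', hba'', haa'', H'⟩ := α.unique_ge (T.isGANR n) ((T.p hnn'').comp l) h
    ((hl.postcomp (T.p hnn'')).trans ((β.compat hnn'').symm.trans hh.symm))
  obtain ⟨r, hr⟩ := hmov a'' haa''
  refine ⟨(((l.comp (S.p hba'')).comp r).comp k).comp (T.p hmn'), ?_⟩
  exact ((H'.precomp r).precomp (k.comp (T.p hmn'))).trans
    (((hr.postcomp h).precomp (k.comp (T.p hmn'))).trans H.symm)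

end Association

/-- The pull-back of a sequence along a monotone map. -/
def reindex (T : GANRSystem G ℕ) (n : ℕ → ℕ) (hn : Monotone n) : GANRSystem G ℕ where
  obj k := T.obj (n k)
  isGANR k := T.isGANR (n k)
  p h := T.p (hn h)
  p_refl k := T.p_refl (n k)
  p_trans hab hbc := T.p_trans (hn hab) (hn hbc)

/-- Since `k ≤ n k`, the subsequence is cofinal: a factorization or a homotopy found at any stage of
`T` can be pulled back to a stage of the subsequence. -/
theorem Association.reindex {T : GANRSystem G ℕ} (β : T.Association X) (n : ℕ → ℕ)
    (hn : Monotone n) (hcof : ∀ k, k ≤ n k) : (T.reindex n hn).IsAssociated X := by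
  refine ⟨⟨fun k => β.proj (n k), fun h => β.compat (hn h), fun P hP f => ?_,
    fun P hP a φ ψ h => ?_⟩⟩
  · obtain ⟨a, h, hh⟩ := β.factor P hP f
    exact ⟨a, h.comp (T.p (hcof a)), ((β.compat (hcof a)).symm.postcomp h).trans hh⟩
  · obtain ⟨c, hc, H⟩ := β.unique P hP (n a) φ ψ h
    have hc' : n a ≤ n (max a c) := hn (le_max_left _ _)
    have hcn : c ≤ n (max a c) := (le_max_right _ _).trans (hcof _)
    refine ⟨max a c, le_max_left _ _, ?_⟩
    have := H.precomp (T.p hcn)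
    have e : T.p hc' = (T.p hc).comp (T.p hcn) := (T.p_trans hc hcn).symm
    change (φ.comp (T.p hc')).Homotopic (ψ.comp (T.p hc'))
    rw [e]
    exact this

/-- A movable sequence has a cofinal canonical subsequence. -/
theorem IsMovable.exists_reindex_isCanonical {T : GANRSystem G ℕ} (hT : T.IsMovable) :
    ∃ (n : ℕ → ℕ) (hn : Monotone n), (∀ k, k ≤ n k) ∧ (T.reindex n hn).IsCanonical := by
  choose μ hμ hmov using hT
  -- Passing `μ (n k)` lets maps out of the movability index of `n k` be defined on term `k + 1`;
  -- the `+ 1` forces strict growth. Starting at `μ 0` supplies a map out of term 0, for which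
  -- canonicity demands no homotopy.
  let n : ℕ → ℕ := fun k => Nat.rec (μ 0) (fun _ m => max (m + 1) (μ m)) k
  have hsucc (k : ℕ) : n (k + 1) = max (n k + 1) (μ (n k)) := rfl
  have hlt : StrictMono n := strictMono_nat_of_lt_succ fun k => by
    rw [hsucc]; exact lt_of_lt_of_le (Nat.lt_succ_self _) (le_max_left _ _)
  refine ⟨n, hlt.monotone, fun _ => hlt.le_apply, fun k => ?_⟩
  cases k with
  | zero =>
    obtain ⟨r, -⟩ := hmov 0 (n 1) (Nat.zero_le _)
    exact ⟨r, fun j h => absurd h (Nat.not_lt_zero j)⟩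
  | succ k =>
    have hk : n k ≤ n (k + 2) := hlt.monotone (Nat.le_add_right k 2)
    have hμk : μ (n k) ≤ n (k + 1) := by rw [hsucc]; exact le_max_right _ _
    -- The homotopy holds after projection to `n k`, hence to `n j` for all `j ≤ k`: exactly the
    -- range `j < k + 1` required.
    obtain ⟨r, hr⟩ := hmov (n k) (n (k + 2)) hk
    refine ⟨r.comp (T.p hμk), fun j h => ?_⟩
    have hjk : n j ≤ n k := hlt.monotone (Nat.le_of_lt_succ h)
    have H := (hr.precomp (T.p hμk)).postcomp (T.p hjk)
    have e₁ : (T.p (hμ (n k))).comp (T.p hμk) = T.p ((hμ (n k)).trans hμk) := T.p_trans _ _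
    have e₂ := T.p_trans hjk ((hμ (n k)).trans hμk)
    have e₃ := T.p_comp_comp hjk hk (r.comp (T.p hμk))
    rw [e₁, e₂] at H
    exact (GMap.Homotopic.of_eq e₃.symm).trans H

/-- In a canonical sequence every term maps coherently to the whole sequence. -/
theorem IsCanonical.exists_coherent {T : GANRSystem G ℕ} (hT : T.IsCanonical) (k : ℕ) :
    ∃ f : ∀ j, GMap (T.obj k) (T.obj j),
      ∀ {i j : ℕ} (h : i ≤ j), (f i).Homotopic ((T.p h).comp (f j)) := by
  choose r hr using hT
  let s : ∀ m, GMap (T.obj k) (T.obj (k + m)) := fun m =>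
    Nat.rec (GMap.id _) (fun m f => (r (k + m)).comp f) m
  have step (j m : ℕ) (h : j < k + m) :
      ((T.p (h.le.trans (Nat.le_succ _))).comp (s (m + 1))).Homotopic ((T.p h.le).comp (s m)) :=
    (hr (k + m) j h).precomp (s m)
  have stable (j m d : ℕ) (h : j < k + m) :
      ((T.p (h.le.trans (by omega : k + m ≤ k + (m + d)))).comp (s (m + d))).Homotopic
        ((T.p h.le).comp (s m)) := by
    induction d with
    | zero => exact .refl _
    | succ d ih => exact (step j (m + d) (by omega)).trans ih
  -- The shift `j + 1` ensures `j < k + (j + 1)` even for `k = 0`, so this iterate is already in the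
  -- stable range.
  refine ⟨fun j => (T.p (by omega : j ≤ k + (j + 1))).comp (s (j + 1)), fun {i j} h => ?_⟩
  rw [T.p_comp_comp]
  obtain ⟨d, rfl⟩ := Nat.exists_eq_add_of_le h
  have := stable i (i + 1) d (by omega)
  have e : i + 1 + d = i + d + 1 := by omega
  -- The type of `s q` depends on `q`, so the index equality `e` is substituted through a variable.
  have key (q : ℕ) (hq : i + 1 + d = q) (h₁ : i ≤ k + q) :
      ((T.p (by omega : i ≤ k + (i + 1))).comp (s (i + 1))).Homotopic ((T.p h₁).comp (s q)) := by
    subst hq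
    exact this.symm
  exact key _ e _

/-- The constant system on a `G`-ANR. -/
def const (P : GSpace G) (hP : IsGANR P) : GANRSystem G PUnit.{w + 1} where
  obj _ := P
  isGANR _ := hP
  p _ := GMap.id P
  p_refl _ := rfl
  p_trans _ _ := rfl

/-- A `G`-ANR is associated with its constant system. -/
def constAssociation (P : GSpace G) (hP : IsGANR P) : (const.{u, w} P hP).Association P where
  proj _ := GMap.id P
  compat _ := .refl _
  factor _ _ f := ⟨PUnit.unit, f, .refl _⟩
  unique _ _ _ _ _ h := ⟨PUnit.unit, le_rfl, h⟩

end GANRSystem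

open GANRSystem

/-! ### Shape morphisms between X and the terms -/

/-- The terms of a canonical sequence associated with `X` are weakly comparable with `X`. -/
theorem GANRSystem.IsCanonical.weaklyGShapeComparable {G : Type u} [Group G] [TopologicalSpace G]
    {X : GSpace G} {A : Type u} [Preorder A] [IsDirectedOrder A] [Nonempty A]
    {S : GANRSystem G A} (α : S.Association X) {T : GANRSystem G ℕ} (β : T.Association X)
    (hT : T.IsCanonical) (k : ℕ) : WeaklyGShapeComparable X (T.obj k) := by
  -- Representatives need index sets in `Type u`, so `X` is represented by `S` rather than by the
  -- sequence `T`.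
  constructor
  · obtain ⟨a, h, -⟩ := α.factor _ (T.isGANR k) (β.proj k)
    exact ⟨Quot.mk _ ⟨A, PUnit, S, const _ (T.isGANR k), α, constAssociation _ _,
      ⟨fun _ => a, fun _ => h, fun _ => ⟨a, le_rfl, le_rfl, .refl _⟩⟩⟩⟩
  · obtain ⟨f, hf⟩ := hT.exists_coherent k
    choose m l hl using fun a => β.factor _ (S.isGANR a) (α.proj a)
    refine ⟨Quot.mk _ ⟨PUnit, A, const _ (T.isGANR k), S, constAssociation _ _, α,
      ⟨fun _ => PUnit.unit, fun a => (l a).comp (f (m a)), fun {a a'} h => ?_⟩⟩⟩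
    -- The `l a` are chosen independently; they are compatible on `X`, hence at a late stage `c`,
    -- and coherence of `f` transports this to term `k`.
    obtain ⟨c, hc, hc', H⟩ := β.unique_ge (S.isGANR a) (l a) ((S.p h).comp (l a'))
      ((hl a).trans ((α.compat h).trans ((hl a').symm.postcomp _)))
    exact ⟨PUnit.unit, le_rfl, le_rfl, ((hf hc).postcomp (l a)).trans
      ((H.precomp (f c)).trans ((hf hc').symm.postcomp ((S.p h).comp (l a'))))⟩

/-! ### Extension and embedding for normed spaces -/

/-- Dugundji's extension theorem for maps to a normed space. -/
theorem exists_continuousMap_extension {W E : Type*} [TopologicalSpace W]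
    [TopologicalSpace.MetrizableSpace W] [NormedAddCommGroup E] [NormedSpace ℝ E] {A : Set W}
    (hA : IsClosed A) (f : C(A, E)) : ∃ F : C(W, E), ∀ a : A, F a = f a := by
  classical
  let _ := TopologicalSpace.metrizableSpaceMetric W
  rcases A.eq_empty_or_nonempty with rfl | hne
  · exact ⟨ContinuousMap.const W 0, fun a => a.2.elim⟩
  -- Off `A`, the value is an average of values of `f` at nearly closest points. A single such point
  -- stays admissible nearby, so a partition of unity gives a continuous selection.
  let t : (Aᶜ : Set W) → Set E := fun w =>
    convexHull ℝ (f '' {a : A | dist (w : W) a < 2 * Metric.infDist (w : W) A})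
  obtain ⟨k, hk⟩ : ∃ k : C((Aᶜ : Set W), E), ∀ w, k w ∈ t w := by
    refine exists_continuous_forall_mem_convex_of_local_const
      (fun w => convex_convexHull ℝ _) fun w => ?_
    have hpos : 0 < Metric.infDist (w : W) A := (hA.notMem_iff_infDist_pos hne).1 w.2
    obtain ⟨a, ha, hlt⟩ := (Metric.infDist_lt_iff (r := 2 * Metric.infDist (w : W) A) hne).1
      (by linarith)
    refine ⟨f ⟨a, ha⟩, ?_⟩
    have h₁ : Continuous fun y : (Aᶜ : Set W) => dist (y : W) a := by fun_prop
    have h₂ : Continuous fun y : (Aᶜ : Set W) => 2 * Metric.infDist (y : W) A :=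
      continuous_const.mul ((Metric.continuous_infDist_pt A).comp continuous_subtype_val)
    filter_upwards [h₁.continuousAt.eventually_lt h₂.continuousAt hlt] with y hy
    exact subset_convexHull ℝ _ ⟨⟨a, ha⟩, hy, rfl⟩
  let F : W → E := fun w => if h : w ∈ A then f ⟨w, h⟩ else k ⟨w, h⟩
  refine ⟨⟨F, continuous_iff_continuousAt.2 fun w => ?_⟩, fun a => dif_pos a.2⟩
  by_cases hw : w ∈ A
  · rw [Metric.continuousAt_iff]
    intro ε hε
    obtain ⟨δ, hδ, hf⟩ := Metric.continuousAt_iff.1 (f.continuous.continuousAt (x := ⟨w, hw⟩)) ε hε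
    -- An admissible `a` for `y` satisfies d(y, a) < 2 d(y, w), so d(a, w) < 3 d(y, w).
    refine ⟨δ / 3, by positivity, fun {y} hy => ?_⟩
    have hFw : F w = f ⟨w, hw⟩ := dif_pos hw
    rw [hFw]
    by_cases hyA : y ∈ A
    · have hFy : F y = f ⟨y, hyA⟩ := dif_pos hyA
      rw [hFy]
      exact hf (show dist y w < δ by linarith)
    · have hFy : F y = k ⟨y, hyA⟩ := dif_neg hyA
      rw [hFy]
      refine convexHull_min ?_ (convex_ball (f ⟨w, hw⟩) ε) (hk ⟨y, hyA⟩)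
      rintro _ ⟨a, ha, rfl⟩
      have ha' : dist y (a : W) < 2 * Metric.infDist y A := ha
      have := Metric.infDist_le_dist_of_mem (x := y) hw
      have := dist_triangle_left (a : W) w y
      exact hf (show dist (a : W) w < δ by linarith)
  · have : ContinuousOn F Aᶜ := by
      rw [continuousOn_iff_continuous_domRestrict]
      convert k.continuous using 1
      ext y
      exact dif_neg y.2
    exact this.continuousAt (hA.isOpen_compl.mem_nhds hw)

/-- Every metrizable space embeds in the normed space of bounded continuous functions on it. -/
theorem exists_isEmbedding_boundedContinuousFunction (P : Type*) [TopologicalSpace P]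
    [TopologicalSpace.MetrizableSpace P] :
    ∃ κ : P → BoundedContinuousFunction P ℝ, IsEmbedding κ := by
  let _ := TopologicalSpace.metrizableSpaceMetric P
  have hlip (a b : ℝ) : dist (min 1 a) (min 1 b) ≤ dist a b := by
    simpa [Real.dist_eq] using abs_min_sub_min_le_max 1 a 1 b
  -- Kuratowski's embedding; truncating distances at 1 gives bounded functions and keeps small
  -- distances.
  let κ : P → BoundedContinuousFunction P ℝ := fun p =>
    BoundedContinuousFunction.ofNormedAddCommGroup (fun q => min 1 (dist p q)) (by fun_prop) 1
      fun q => by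
        rw [Real.norm_of_nonneg (le_min zero_le_one dist_nonneg)]
        exact min_le_left _ _
  have hup (p q : P) : dist (κ p) (κ q) ≤ dist p q :=
    (BoundedContinuousFunction.dist_le dist_nonneg).2 fun x =>
      (hlip _ _).trans (dist_dist_dist_le_left p q x)
  have hlow (p q : P) : min 1 (dist p q) ≤ dist (κ p) (κ q) := by
    refine le_trans ?_ (BoundedContinuousFunction.dist_coe_le_dist q)
    change _ ≤ dist (min 1 (dist p q)) (min 1 (dist q q))
    simp [le_abs_self]
  refine ⟨κ, (Metric.isUniformEmbedding_iff'.2 ⟨fun ε hε => ⟨ε, hε, fun h => (hup _ _).trans_lt h⟩,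
    fun δ hδ => ⟨min 1 δ, lt_min one_pos hδ, fun {p q} h => ?_⟩⟩).isEmbedding⟩
  have := (hlow p q).trans_lt h
  by_contra! hcon
  exact absurd (min_le_min_left 1 hcon) (not_le.2 this)

/-! ### Coinduced G-spaces as equivariant absolute extensors -/

namespace GSpace

variable {G : Type u} [Group G] [TopologicalSpace G] [IsTopologicalGroup G] [CompactSpace G]

/-- The action of `G` on functions on `G` by left translation. -/
@[reducible] def coinducedAction (G : Type u) [Group G] [TopologicalSpace G] [IsTopologicalGroup G]
    (E : Type u) [TopologicalSpace E] : MulAction G C(G, E) where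
  smul g φ := φ.comp ⟨fun x => g⁻¹ * x, by fun_prop⟩
  one_smul φ := by
    ext x
    change φ (1⁻¹ * x) = φ x
    simp
  mul_smul g h φ := by
    ext x
    change φ ((g * h)⁻¹ * x) = φ (h⁻¹ * (g⁻¹ * x))
    simp [mul_assoc]

/-- The continuous functions on `G`, on which `G` acts by left translation. -/
def coinduced (G : Type u) [Group G] [TopologicalSpace G] [IsTopologicalGroup G]
    [CompactSpace G] (E : Type u) [NormedAddCommGroup E] : GSpace G :=
  letI := coinducedAction G E
  { carrier := C(G, E)
    cont := ⟨by
      refine ContinuousMap.continuous_of_continuous_uncurry _ ?_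
      change Continuous fun q : (G × C(G, E)) × G => q.1.2 (q.1.1⁻¹ * q.2)
      fun_prop⟩ }

section coinduced

variable {E : Type u} [NormedAddCommGroup E]

instance : TopologicalSpace.MetrizableSpace (coinduced G E) :=
  inferInstanceAs (TopologicalSpace.MetrizableSpace C(G, E))

instance : FunLike (coinduced G E) G E := inferInstanceAs (FunLike C(G, E) G E)

theorem coinduced_ext {φ ψ : coinduced G E} (h : ∀ x, φ x = ψ x) : φ = ψ := DFunLike.ext φ ψ h

theorem coinduced_smul_apply (g : G) (φ : coinduced G E) (x : G) : (g • φ) x = φ (g⁻¹ * x) := rfl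

theorem continuous_coinduced_apply (x : G) : Continuous fun φ : coinduced G E => φ x :=
  ContinuousEvalConst.continuous_eval_const (F := C(G, E)) x

end coinduced

/-- The product action of `G` on `W × T`, with `G` acting trivially on `T`. -/
@[reducible] def prodTrivialAction {G : Type u} [Group G] [TopologicalSpace G] (W : GSpace G)
    (T : Type) : MulAction G (W × T) where
  smul g q := (g • q.1, q.2)
  one_smul q := Prod.ext (one_smul G q.1) rfl
  mul_smul g h q := Prod.ext (mul_smul g h q.1) rfl

/-- The product of a `G`-space with a space on which `G` acts trivially. -/
def prodTrivial {G : Type u} [Group G] [TopologicalSpace G] (W : GSpace G) (T : Type)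
    [TopologicalSpace T] : GSpace G :=
  letI := prodTrivialAction W T
  { carrier := W × T
    cont := ⟨by
      change Continuous fun q : G × (W × T) => (q.1 • q.2.1, q.2.2)
      fun_prop⟩ }

instance {G : Type u} [Group G] [TopologicalSpace G] (W : GSpace G) (T : Type)
    [TopologicalSpace T] [TopologicalSpace.MetrizableSpace W] [TopologicalSpace.MetrizableSpace T] :
    TopologicalSpace.MetrizableSpace (W.prodTrivial T) :=
  inferInstanceAs (TopologicalSpace.MetrizableSpace (W × T))

instance {G : Type u} [Group G] [TopologicalSpace G] (W : GSpace G)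
    [TopologicalSpace.MetrizableSpace W] (U : SubMulAction G W) :
    TopologicalSpace.MetrizableSpace (W.ofInvariant U) :=
  inferInstanceAs (TopologicalSpace.MetrizableSpace (U : Set W))

end GSpace

namespace GMap

variable {G : Type u} [Group G] [TopologicalSpace G]

/-- The inclusion of an invariant subset. -/
def incl {Z : GSpace G} (U : SubMulAction G Z) : GMap (Z.ofInvariant U) Z where
  toFun := Subtype.val
  continuous_toFun := continuous_subtype_val
  map_smul' _ _ := rfl

/-- The corestriction of a `G`-map to an invariant subset. -/
def codRestrict {W Z : GSpace G} (f : GMap W Z) (U : SubMulAction G Z) (h : ∀ w, f w ∈ U) :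
    GMap W (Z.ofInvariant U) where
  toFun w := ⟨f w, h w⟩
  continuous_toFun := f.continuous.subtype_mk h
  map_smul' g w := Subtype.ext (f.map_smul g w)

/-- The inverse image of an invariant subset. -/
def preimage {W Z : GSpace G} (f : GMap W Z) (U : SubMulAction G Z) : SubMulAction G W where
  carrier := f ⁻¹' U
  smul_mem' g w hw := by
    change f (g • w) ∈ U
    rw [f.map_smul]
    exact U.smul_mem g hw

/-- The range of a `G`-map. -/
def range {W Z : GSpace G} (f : GMap W Z) : SubMulAction G Z where
  carrier := Set.range f
  smul_mem' g := by
    rintro _ ⟨w, rfl⟩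
    exact ⟨g • w, f.map_smul g w⟩

variable [IsTopologicalGroup G] [CompactSpace G]

/-- The `G`-map to a coinduced space determined by a map to a normed space. -/
def toCoinduced {W : GSpace G} {E : Type u} [NormedAddCommGroup E] (Φ : C(W, E)) :
    GMap W (GSpace.coinduced G E) where
  toFun w := (⟨fun x => Φ (x⁻¹ • w), by fun_prop⟩ : C(G, E))
  continuous_toFun := by
    refine ContinuousMap.continuous_of_continuous_uncurry _ ?_
    change Continuous fun q : W × G => Φ (q.2⁻¹ • q.1)
    fun_prop
  map_smul' g w := by
    refine GSpace.coinduced_ext fun x => ?_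
    change Φ (x⁻¹ • g • w) = Φ ((g⁻¹ * x)⁻¹ • w)
    rw [smul_smul, mul_inv_rev, inv_inv]

/-- Coinduced spaces are equivariant absolute extensors. -/
theorem exists_extension_coinduced {W : GSpace G} [TopologicalSpace.MetrizableSpace W] {E : Type u}
    [NormedAddCommGroup E] [NormedSpace ℝ E] {A : SubMulAction G W} (hA : IsClosed (A : Set W))
    (f : GMap (W.ofInvariant A) (GSpace.coinduced G E)) :
    ∃ F : GMap W (GSpace.coinduced G E), ∀ a : A, F a = f a := by
  -- Only the value at 1 is extended; equivariance recovers the rest, as f(a)(x) = f(x⁻¹a)(1).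
  obtain ⟨Φ, hΦ⟩ := exists_continuousMap_extension hA
    (⟨fun a => f a 1, (GSpace.continuous_coinduced_apply (1 : G)).comp f.continuous⟩ :
      C((A : Set W), E))
  refine ⟨toCoinduced Φ, fun a => GSpace.coinduced_ext fun x => ?_⟩
  refine (hΦ (x⁻¹ • a : A)).trans ?_
  have h : f (x⁻¹ • a : A) = x⁻¹ • f a := f.map_smul x⁻¹ a
  change f (x⁻¹ • a : A) 1 = f a x
  rw [h, GSpace.coinduced_smul_apply]
  simp

/-- Every metrizable `G`-space embeds in a coinduced space. -/
theorem exists_isEmbedding_coinduced (P : GSpace G) [TopologicalSpace.MetrizableSpace P] :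
    ∃ κ : GMap P (GSpace.coinduced G (BoundedContinuousFunction P ℝ)), IsEmbedding κ := by
  obtain ⟨κ, hκ⟩ := exists_isEmbedding_boundedContinuousFunction P
  refine ⟨toCoinduced ⟨κ, hκ.continuous⟩, IsEmbedding.of_comp (GMap.continuous _)
    (g := fun φ => φ 1) (GSpace.continuous_coinduced_apply 1) ?_⟩
  convert hκ using 1
  ext1 p
  change κ ((1 : G)⁻¹ • p) = κ p
  simp

end GMap

/-! ### G-ANRs as equivariant neighbourhood extensors -/

section

variable {G : Type u} [Group G] [TopologicalSpace G] [CompactSpace G]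

/-- Open invariant subsets of coinduced spaces are `G`-ANRs. -/
theorem isGANR_of_isOpen [IsTopologicalGroup G] {E : Type u} [NormedAddCommGroup E] [NormedSpace ℝ E]
    {U : SubMulAction G (GSpace.coinduced G E)} (hU : IsOpen (U : Set (GSpace.coinduced G E))) :
    IsGANR ((GSpace.coinduced G E).ofInvariant U) := by
  refine ⟨inferInstance, fun Z hZ i hi => ?_⟩
  let e := hi.isEmbedding.toHomeomorph
  have he (y : (GSpace.coinduced G E).ofInvariant U) (h) : e.symm ⟨i y, h⟩ = y :=
    e.symm_apply_apply y
  let f : GMap (Z.ofInvariant i.range) (GSpace.coinduced G E) :=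
    { toFun := fun a => GMap.incl U (e.symm a)
      continuous_toFun := (GMap.incl U).continuous.comp e.symm.continuous
      map_smul' := by
        rintro g ⟨_, y, rfl⟩
        have h : g • (⟨i y, y, rfl⟩ : i.range) = ⟨i (g • y), g • y, rfl⟩ :=
          Subtype.ext (i.map_smul g y).symm
        change GMap.incl U (e.symm (g • (⟨i y, y, rfl⟩ : i.range) : i.range)) =
          g • GMap.incl U (e.symm ⟨i y, y, rfl⟩)
        rw [h]
        exact (congrArg (GMap.incl U) (he (g • y) _)).trans (((GMap.incl U).map_smul g y).trans
          (congrArg (fun z => g • GMap.incl U z) (he y _).symm)) }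
  obtain ⟨F, hF⟩ := GMap.exists_extension_coinduced hi.isClosed_range f
  have hFi (y : (GSpace.coinduced G E).ofInvariant U) : F (i y) = GMap.incl U y :=
    (hF ⟨i y, y, rfl⟩).trans (congrArg (GMap.incl U) (he y ⟨y, rfl⟩))
  refine ⟨F.preimage U, (hU.preimage F.continuous).mem_nhdsSet.2 ?_,
    (F.comp (GMap.incl _)).codRestrict U fun w => w.2, fun y _ => Subtype.ext (hFi y)⟩
  rintro _ ⟨y, rfl⟩
  change F (i y) ∈ U
  rw [hFi]
  exact y.2

/-- A closed invariant subset of a metrizable `G`-space is the zero set of an invariant function. -/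
theorem SubMulAction.exists_invariant_function {W : GSpace G} [TopologicalSpace.MetrizableSpace W]
    {A : SubMulAction G W} (hA : IsClosed (A : Set W)) :
    ∃ t : C(W, ℝ), (∀ (g : G) w, t (g • w) = t w) ∧ (∀ w, 0 ≤ t w) ∧ ∀ w, t w = 0 ↔ w ∈ A := by
  let _ := TopologicalSpace.metrizableSpaceMetric W
  rcases (A : Set W).eq_empty_or_nonempty with he | hne
  -- `Metric.infDist` to the empty set is 0, so the general formula would vanish everywhere.
  · refine ⟨ContinuousMap.const W 1, fun _ _ => rfl, fun _ => zero_le_one, fun w => ?_⟩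
    have : w ∉ (A : Set W) := by simp [he]
    simpa using this
  -- The function sought is the supremum of d(xw, A) over x in G: a sup norm, continuous because G
  -- is compact.
  let d : C(W, C(G, ℝ)) := ContinuousMap.curry
    ⟨fun q => Metric.infDist (q.2 • q.1) A,
      (Metric.continuous_infDist_pt _).comp (continuous_snd.smul continuous_fst)⟩
  have hd (w : W) (x : G) : d w x = Metric.infDist (x • w) A := rfl
  have hle (g : G) (w : W) : ‖d (g • w)‖ ≤ ‖d w‖ := by
    refine (ContinuousMap.norm_le _ (norm_nonneg _)).2 fun x => ?_
    rw [hd, smul_smul, ← hd]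
    exact (d w).norm_coe_le_norm _
  refine ⟨⟨fun w => ‖d w‖, d.continuous.norm⟩, fun g w => (hle g w).antisymm ?_,
    fun w => norm_nonneg (d w), fun w => ?_⟩
  · simpa using hle g⁻¹ (g • w)
  · change ‖d w‖ = 0 ↔ _
    rw [norm_eq_zero, ContinuousMap.ext_iff]
    constructor
    · intro h
      have := h 1
      rw [hd, one_smul] at this
      exact (hA.mem_iff_infDist_zero hne).2 this
    · intro h x
      rw [hd]
      exact (hA.mem_iff_infDist_zero hne).1 (A.smul_mem x h)

/-- Every `G`-ANR is an equivariant absolute neighbourhood extensor for metrizable `G`-spaces. -/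
theorem IsGANR.exists_extension [IsTopologicalGroup G] {P : GSpace G} (hP : IsGANR P) {W : GSpace G}
    [TopologicalSpace.MetrizableSpace W] {A : SubMulAction G W} (hA : IsClosed (A : Set W))
    (f : GMap (W.ofInvariant A) P) :
    ∃ V : SubMulAction G W, (V : Set W) ∈ 𝓝ˢ (A : Set W) ∧
      ∃ F : GMap (W.ofInvariant V) P, ∀ (w : W) (h : w ∈ V) (ha : w ∈ A), F ⟨w, h⟩ = f ⟨w, ha⟩ := by
  have := hP.1
  obtain ⟨κ, hκ⟩ := GMap.exists_isEmbedding_coinduced P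
  let L := GSpace.coinduced G (BoundedContinuousFunction P ℝ)
  -- The image of `κ` need not be closed in `L`. Placing it at height 0 below the open half-space
  -- makes it closed in `Z`.
  let Z : SubMulAction G (L.prodTrivial ℝ) :=
    { carrier := {q | 0 < q.2 ∨ (q.2 = 0 ∧ q.1 ∈ κ.range)}
      smul_mem' := fun g q hq => hq.imp id fun h => ⟨h.1, κ.range.smul_mem g h.2⟩ }
  let j : GMap P (L.prodTrivial ℝ) :=
    { toFun := fun p => (κ p, 0)
      continuous_toFun := κ.continuous.prodMk continuous_const
      map_smul' := fun g p => Prod.ext (κ.map_smul g p) rfl }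
  let i : GMap P ((L.prodTrivial ℝ).ofInvariant Z) :=
    j.codRestrict Z fun p => Or.inr ⟨rfl, p, rfl⟩
  have hi : IsClosedEmbedding i := by
    have hfst : Continuous fun z : (L.prodTrivial ℝ).ofInvariant Z => (Subtype.val z : L × ℝ).1 :=
      continuous_fst.comp continuous_subtype_val
    refine ⟨IsEmbedding.of_comp i.continuous hfst hκ, ?_⟩
    have hsnd : Continuous fun z : (L.prodTrivial ℝ).ofInvariant Z => (Subtype.val z : L × ℝ).2 :=
      continuous_snd.comp continuous_subtype_val
    have : Set.range i = {z : (L.prodTrivial ℝ).ofInvariant Z | (Subtype.val z : L × ℝ).2 ≤ 0} := by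
      ext z
      constructor
      · rintro ⟨p, rfl⟩
        exact le_refl (0 : ℝ)
      · intro hz
        rcases z.2 with h | ⟨h, p, hp⟩
        · exact absurd h (not_lt.2 hz)
        · exact ⟨p, Subtype.ext (Prod.ext hp h.symm)⟩
    rw [this]
    exact isClosed_le hsnd continuous_const
  obtain ⟨U, hU, r, hr⟩ := hP.2 _ inferInstance i hi
  obtain ⟨F, hF⟩ := GMap.exists_extension_coinduced hA (κ.comp f)
  obtain ⟨t, htinv, htpos, htA⟩ := SubMulAction.exists_invariant_function hA
  -- As `t` vanishes only on `A`, where `F` lies in the image of `κ`, the map `(F, t)` lands in `Z`;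
  -- the retraction onto `P` is then pulled back along it.
  let H : GMap W ((L.prodTrivial ℝ).ofInvariant Z) := GMap.codRestrict
    { toFun := fun w => (F w, t w)
      continuous_toFun := F.continuous.prodMk t.continuous
      map_smul' := fun g w => Prod.ext (F.map_smul g w) (htinv g w) } Z fun w => by
        rcases (htpos w).lt_or_eq with h | h
        · exact Or.inl h
        · exact Or.inr ⟨h.symm, f ⟨w, (htA w).1 h.symm⟩, (hF ⟨w, (htA w).1 h.symm⟩).symm⟩
  have hHA (w : W) (hw : w ∈ A) : H w = i (f ⟨w, hw⟩) :=
    Subtype.ext (Prod.ext (hF ⟨w, hw⟩) ((htA w).2 hw))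
  refine ⟨H.preimage U, ?_,
    r.comp ((H.comp (GMap.incl _)).codRestrict U fun w => w.2), fun w h ha => ?_⟩
  · rw [mem_nhdsSet_iff_forall] at hU ⊢
    intro w hw
    refine H.continuous.continuousAt.preimage_mem_nhds ?_
    rw [hHA w hw]
    exact hU _ ⟨_, rfl⟩
  · have h' : i (f ⟨w, ha⟩) ∈ U := by
      rw [← hHA w ha]; exact h
    refine Eq.trans (congrArg r (Subtype.ext ?_)) (hr (f ⟨w, ha⟩) h')
    exact hHA w ha

end

/-! ### Neighbourhood sequences associated with a compact G-space -/

section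

variable {G : Type u} [Group G] [TopologicalSpace G] [CompactSpace G]

/-- The decreasing sequence of `G`-ANRs in an ambient `G`-space, with the inclusions. -/
def GANRSystem.ofAntitone {M : GSpace G} (U : ℕ → SubMulAction G M) (hU : Antitone U)
    (hG : ∀ n, IsGANR (M.ofInvariant (U n))) : GANRSystem G ℕ where
  obj n := M.ofInvariant (U n)
  isGANR := hG
  p h := (GMap.incl _).codRestrict _ fun x => hU h x.2
  p_refl _ := rfl
  p_trans _ _ := rfl

variable [IsTopologicalGroup G]

/-- Two `G`-maps from an invariant set `U` to a `G`-ANR which are `G`-homotopic on a compact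
invariant subset are `G`-homotopic on a neighbourhood of that subset. -/
theorem IsGANR.exists_homotopy_extension {P : GSpace G} (hP : IsGANR P) {X W : GSpace G}
    [CompactSpace X] [TopologicalSpace.MetrizableSpace W] (κ : GMap X W) (hκ : IsEmbedding κ)
    (φ ψ : GMap W P) (h : (φ.comp κ).Homotopic (ψ.comp κ)) :
    ∃ V ∈ 𝓝ˢ (Set.range κ), ∀ (Y : GSpace G) (l : GMap Y W), (∀ y, l y ∈ V) →
      (φ.comp l).Homotopic (ψ.comp l) := by
  classical
  obtain ⟨H, hH⟩ := h
  let A : SubMulAction G (W.prodTrivial unitInterval) :=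
    { carrier := {q | q.1 ∈ Set.range κ ∨ q.2 = 0 ∨ q.2 = 1}
      smul_mem' := fun g q hq => hq.imp (fun h => κ.range.smul_mem g h) id }
  let e := hκ.toHomeomorph
  have he (x : X) (h) : e.symm ⟨κ x, h⟩ = x := e.symm_apply_apply x
  -- The given homotopy over the compact set is glued to `φ` and `ψ` at the two ends. Outside `A`
  -- the value is junk and never used.
  let f₀ : W × unitInterval → P := fun q =>
    if h : q.1 ∈ Set.range κ then H (q.2, e.symm ⟨q.1, h⟩) else if q.2 = 0 then φ q.1 else ψ q.1
  have hf₀ (x : X) (t : unitInterval) : f₀ (κ x, t) = H (t, x) := by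
    have : κ x ∈ Set.range κ := ⟨x, rfl⟩
    simp only [f₀, dif_pos this, he]
  have hf₁ (w : W) : f₀ (w, 0) = φ w := by
    by_cases hw : w ∈ Set.range κ
    · obtain ⟨x, rfl⟩ := hw
      rw [hf₀]
      exact H.apply_zero x
    · exact (dif_neg hw).trans (if_pos rfl)
  have hf₂ (w : W) : f₀ (w, 1) = ψ w := by
    by_cases hw : w ∈ Set.range κ
    · obtain ⟨x, rfl⟩ := hw
      rw [hf₀]
      exact H.apply_one x
    · exact (dif_neg hw).trans (if_neg one_ne_zero)
  have hK : IsClosed (Set.range κ) := (isCompact_range κ.continuous).isClosed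
  have hA₁ : IsClosed {q : W × unitInterval | q.1 ∈ Set.range κ} := hK.preimage continuous_fst
  have hA₂ : IsClosed {q : W × unitInterval | q.2 = 0} := isClosed_eq continuous_snd continuous_const
  have hA₃ : IsClosed {q : W × unitInterval | q.2 = 1} := isClosed_eq continuous_snd continuous_const
  have hA : IsClosed (A : Set (W.prodTrivial unitInterval)) := hA₁.union (hA₂.union hA₃)
  have hc₁ : ContinuousOn f₀ {q : W × unitInterval | q.1 ∈ Set.range κ} := by
    rw [continuousOn_iff_continuous_domRestrict]
    have : Continuous fun q : {q : W × unitInterval | q.1 ∈ Set.range κ} =>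
        H (q.1.2, e.symm ⟨q.1.1, q.2⟩) := by
      have := e.symm.continuous
      fun_prop
    convert this using 1
    ext ⟨⟨w, t⟩, hw⟩
    exact dif_pos hw
  have hc₂ : ContinuousOn f₀ {q : W × unitInterval | q.2 = 0} := by
    refine (φ.continuous.comp continuous_fst).continuousOn.congr ?_
    rintro ⟨w, t⟩ rfl
    exact hf₁ w
  have hc₃ : ContinuousOn f₀ {q : W × unitInterval | q.2 = 1} := by
    refine (ψ.continuous.comp continuous_fst).continuousOn.congr ?_
    rintro ⟨w, t⟩ rfl
    exact hf₂ w
  have hc : ContinuousOn f₀ (A : Set (W.prodTrivial unitInterval)) :=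
    hc₁.union_of_isClosed (hc₂.union_of_isClosed hc₃ hA₂ hA₃) hA₁ (hA₂.union hA₃)
  let f : GMap ((W.prodTrivial unitInterval).ofInvariant A) P :=
    { toFun := fun a => f₀ a.1
      continuous_toFun := continuousOn_iff_continuous_domRestrict.1 hc
      map_smul' := by
        rintro g ⟨⟨w, t⟩, hw⟩
        change f₀ (g • w, t) = g • f₀ (w, t)
        rcases hw with ⟨x, hx⟩ | ht | ht
        · obtain rfl : κ x = w := hx
          rw [← κ.map_smul, hf₀, hf₀, hH]
        · obtain rfl : t = 0 := ht
          rw [hf₁, hf₁, φ.map_smul]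
        · obtain rfl : t = 1 := ht
          rw [hf₂, hf₂, ψ.map_smul] }
  obtain ⟨V, hV, F, hF⟩ := hP.exists_extension hA f
  refine ⟨{w | ∀ t : unitInterval, (w, t) ∈ (V : Set (W.prodTrivial unitInterval))}, ?_,
    fun Y l hl => ?_⟩
  · rw [mem_nhdsSet_iff_forall] at hV ⊢
    rintro w hw
    -- Tube lemma: compactness of the interval gives a neighbourhood of `w` whose whole cylinder
    -- lies in `V`.
    have := isCompact_univ.eventually_forall_of_forall_eventually (x₀ := w)
      (K := (Set.univ : Set unitInterval))
      (P := fun w t => (w, t) ∈ (V : Set (W.prodTrivial unitInterval)))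
      fun t _ => hV (w, t) (Or.inl hw)
    exact this.mono fun w h t => h t trivial
  · let k : GMap (Y.prodTrivial unitInterval) (W.prodTrivial unitInterval) :=
      { toFun := fun q => (l q.1, q.2)
        continuous_toFun := (l.continuous.comp continuous_fst).prodMk continuous_snd
        map_smul' := fun g q => Prod.ext (l.map_smul g q.1) rfl }
    let K := F.comp (k.codRestrict V fun q => hl q.1 q.2)
    refine ⟨⟨⟨fun q => K (q.2, q.1), K.continuous.comp continuous_swap⟩, fun y => ?_, fun y => ?_⟩,
      fun g t y => K.map_smul g (y, t)⟩
    · exact (hF (l y, 0) _ (Or.inr (Or.inl rfl))).trans (hf₁ (l y))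
    · exact (hF (l y, 1) _ (Or.inr (Or.inr rfl))).trans (hf₂ (l y))

/-- A neighbourhood base of invariant open `G`-ANRs around a compact `G`-space is associated
with it. -/
theorem GANRSystem.ofAntitone_isAssociated {M X : GSpace G} [TopologicalSpace.MetrizableSpace M]
    [CompactSpace X] (κ : GMap X M) (hκ : IsEmbedding κ) (U : ℕ → SubMulAction G M)
    (hU : Antitone U) (hG : ∀ n, IsGANR (M.ofInvariant (U n))) (ho : ∀ n, IsOpen (U n : Set M))
    (hmem : ∀ n x, κ x ∈ U n)
    (hbasis : ∀ V ∈ 𝓝ˢ (Set.range κ), ∃ n, (U n : Set M) ⊆ V) :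
    (GANRSystem.ofAntitone U hU hG).IsAssociated X := by
  refine ⟨⟨fun n => κ.codRestrict (U n) (hmem n), fun _ => .refl _, fun P hP f => ?_,
    fun P hP n φ ψ h => ?_⟩⟩
  · have hK : IsClosed (κ.range : Set M) := (isCompact_range κ.continuous).isClosed
    let e := hκ.toHomeomorph
    have he (x : X) (h) : e.symm ⟨κ x, h⟩ = x := e.symm_apply_apply x
    let k : GMap (M.ofInvariant κ.range) P :=
      { toFun := fun a => f (e.symm a)
        continuous_toFun := f.continuous.comp e.symm.continuous
        map_smul' := by
          rintro g ⟨_, x, rfl⟩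
          have h : g • (⟨κ x, x, rfl⟩ : κ.range) = ⟨κ (g • x), g • x, rfl⟩ :=
            Subtype.ext (κ.map_smul g x).symm
          change f (e.symm (g • (⟨κ x, x, rfl⟩ : κ.range) : κ.range)) =
            g • f (e.symm ⟨κ x, x, rfl⟩)
          rw [h]
          exact (congrArg f (he (g • x) _)).trans ((f.map_smul g x).trans
            (congrArg (fun z => g • f z) (he x _).symm)) }
    obtain ⟨V, hV, F, hF⟩ := hP.exists_extension hK k
    obtain ⟨n, hn⟩ := hbasis V hV
    refine ⟨n, F.comp ((GMap.incl (U n)).codRestrict V fun x => hn x.2), .of_eq ?_⟩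
    refine DFunLike.ext _ _ fun x => ?_
    exact (hF (κ x) _ ⟨x, rfl⟩).trans (congrArg f (he x _))
  · have := (hG n).1
    have hκn : IsEmbedding (κ.codRestrict (U n) (hmem n)) :=
      IsEmbedding.of_comp (GMap.continuous _) (g := GMap.incl (U n)) (GMap.continuous _) hκ
    obtain ⟨V, hV, hVh⟩ := hP.exists_homotopy_extension (κ.codRestrict (U n) (hmem n)) hκn φ ψ h
    -- `V` is a neighbourhood inside `U n`; as `U n` is open, its image is a neighbourhood in `M`.
    obtain ⟨m, hm⟩ := hbasis (GMap.incl (U n) '' V) <| by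
      rw [mem_nhdsSet_iff_forall] at hV ⊢
      rintro _ ⟨x, rfl⟩
      exact (ho n).isOpenEmbedding_subtypeVal.isOpenMap.image_mem_nhds (hV _ ⟨x, rfl⟩)
    refine ⟨max n m, le_max_left _ _, hVh _ _ fun y => ?_⟩
    obtain ⟨v, hv, hvy⟩ := hm (hU (le_max_right n m) y.2)
    have : v = (GANRSystem.ofAntitone U hU hG).p (le_max_left n m) y := Subtype.ext hvy
    exact Set.mem_of_eq_of_mem this.symm hv

/-- The open `δ`-neighbourhood of an invariant set in a coinduced space. -/
def SubMulAction.thickening {E : Type u} [NormedAddCommGroup E] (δ : ℝ)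
    (K : SubMulAction G (GSpace.coinduced G E)) : SubMulAction G (GSpace.coinduced G E) where
  carrier := Metric.thickening (α := C(G, E)) δ (K : Set (GSpace.coinduced G E))
  smul_mem' g φ hφ := by
    obtain ⟨ψ, hψ, hlt⟩ := (Metric.mem_thickening_iff (X := C(G, E))).1 hφ
    have hgψ := K.smul_mem g (x := ψ) hψ
    refine (Metric.mem_thickening_iff (X := C(G, E))).2 ⟨_, hgψ, lt_of_le_of_lt ?_ hlt⟩
    -- Left translation does not increase the sup distance.
    exact (ContinuousMap.dist_le (dist_nonneg (α := C(G, E)))).2 fun x =>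
      ContinuousMap.dist_apply_le_dist (f := (φ : C(G, E))) (g := (ψ : C(G, E))) (g⁻¹ * x)

/-- Every compact metrizable `G`-space has an associated inverse `G`-ANR sequence. -/
theorem GSpace.exists_isAssociated_sequence (X : GSpace G) [CompactSpace X]
    [TopologicalSpace.MetrizableSpace X] : ∃ T : GANRSystem G ℕ, T.IsAssociated X := by
  obtain ⟨κ, hκ⟩ := GMap.exists_isEmbedding_coinduced X
  let U : ℕ → SubMulAction G (GSpace.coinduced G (BoundedContinuousFunction X ℝ)) := fun n =>
    κ.range.thickening (1 / ((n : ℝ) + 1))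
  have ho (n : ℕ) : IsOpen (U n : Set (GSpace.coinduced G (BoundedContinuousFunction X ℝ))) :=
    Metric.isOpen_thickening (α := C(G, BoundedContinuousFunction X ℝ))
  refine ⟨_, GANRSystem.ofAntitone_isAssociated κ hκ U (fun m n h => ?_)
    (fun n => isGANR_of_isOpen (ho n)) ho (fun n x => ?_) fun V hV => ?_⟩
  · exact Metric.thickening_mono (α := C(G, BoundedContinuousFunction X ℝ)) (Nat.one_div_le_one_div h) _
  · exact Metric.self_subset_thickening (α := C(G, BoundedContinuousFunction X ℝ))
      Nat.one_div_pos_of_nat _ ⟨x, rfl⟩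
  -- Compactness of the image of `X` makes its thickenings a neighbourhood base.
  · obtain ⟨δ, hδ, h⟩ := (Metric.hasBasis_nhdsSet_thickening
      (α := C(G, BoundedContinuousFunction X ℝ)) (isCompact_range κ.continuous)).mem_iff.1 hV
    obtain ⟨n, hn⟩ := exists_nat_one_div_lt hδ
    exact ⟨n, (Metric.thickening_mono (α := C(G, BoundedContinuousFunction X ℝ)) hn.le _).trans h⟩

end

/-! ### The main theorem -/

theorem mainTheorem8 {G : Type u} [Group G] [TopologicalSpace G] [IsTopologicalGroup G]
    [CompactSpace G] (X : GSpace G) [CompactSpace X] [TopologicalSpace.MetrizableSpace X]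
    (hX : IsGMovable X) :
    (∃ Y : GSpace G, IsGANR Y ∧ WeaklyGShapeComparable X Y) ∧
      ∃ S : GANRSystem G ℕ, S.IsAssociated X ∧ S.IsCanonical ∧
        ∀ k : ℕ, IsGANR (S.obj k) ∧ WeaklyGShapeComparable X (S.obj k) := by
  obtain ⟨A, _, _, _, S, ⟨α⟩, hS⟩ := hX
  obtain ⟨T, ⟨β⟩⟩ := X.exists_isAssociated_sequence
  obtain ⟨n, hn, hcof, hcan⟩ := (α.isMovable β hS).exists_reindex_isCanonical
  obtain ⟨γ⟩ := β.reindex n hn hcof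
  have hcomp := hcan.weaklyGShapeComparable α γ
  exact ⟨⟨_, (T.reindex n hn).isGANR 0, hcomp 0⟩, T.reindex n hn, ⟨γ⟩, hcan,
    fun k => ⟨(T.reindex n hn).isGANR k, hcomp k⟩⟩
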